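/- A probabilistic finite automaton (PFA) over a finite alphabet $\Sigma$ consists of a finite set of states $Q$, a row-stochastic real matrix $A_\sigma\in\mathbb R^{Q\times Q}$ for each $\sigma\in\Sigma$, an initial state $q_0\in Q$ and a set $F\subseteq Q$ of accepting states. It accepts a word $w=\sigma_1\cdots\sigma_m\in\Sigma^*$ with probability $p(w)=\sum_{q\in F}(A_{\sigma_1}\cdots A_{\sigma_m})_{q_0,q}$. It accepts a language $L\subseteq\Sigma^*$ with cut-point $\lambda$ if $p(w)>\lambda$ for all $w\in L$ and $p(w)\le\lambda$ for all $w\in\Sigma^*\setminus L$. Corollary. Let $X$ be a finite set and let $\Sigma=X\sqcup X^{-1}$ be the alphabet consisting of the generators of the free group $F(X)$ and their formal inverses. Then there exist a PFA over $\Sigma$ and a cut-point $\lambda\in[0,1)$ such that the PFA accepts with cut-point $\lambda$ the word problem of $F(X)$, that is, the language of all words $w\in\Sigma^*$ whose product in $F(X)$ is the identity. -/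

import Mathlib

/-- A probabilistic finite automaton with input alphabet `A` and finite state set `Q`. On reading
the letter `a`, it moves from state `p` to state `q` with probability `trans a p q`. -/
structure PFA (A : Type*) (Q : Type*) [Fintype Q] [DecidableEq Q] where
  /-- The transition matrix of each letter. -/
  trans : A → Matrix Q Q ℝ
  /-- Entries are nonnegative and every row sums to one. -/
  trans_stochastic : ∀ a, trans a ∈ Matrix.rowStochastic ℝ Q
  /-- The initial state. -/
  start : Q
  /-- The set of accepting states. -/
  accept : Finset Q

namespace PFA

variable {A Q : Type*} [Fintype Q] [DecidableEq Q]

/-- The probability that `M`, started in its initial state, is in an accepting state after it has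
read the word `w` from left to right. -/
def acceptProb (M : PFA A Q) (w : List A) : ℝ :=
  ∑ q ∈ M.accept, (w.map M.trans).prod M.start q

/-- `M` accepts the language `L` with cut-point `c`: words of `L` are accepted with probability
greater than `c`, all other words with probability at most `c`. -/
def AcceptsWithCutPoint (M : PFA A Q) (L : Language A) (c : ℝ) : Prop :=
  (∀ w ∈ L, c < M.acceptProb w) ∧ ∀ w, w ∉ L → M.acceptProb w ≤ c

end PFA

/-- The word problem of the free group on `X`: the words over the alphabet of generators `(x, true)`
and inverse generators `(x, false)` whose product in the free group is the identity. -/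
def freeGroupWordProblem (X : Type*) : Language (X × Bool) :=
  {w | FreeGroup.mk w = 1}

open Matrix

namespace PFA

variable {A Q Q' : Type*} [Fintype Q] [DecidableEq Q] [Fintype Q'] [DecidableEq Q']

/-! The free group acts by integral Möbius transformations that play ping-pong on unit discs: a
nonempty reduced word sends ∞ into the disc of its first letter, so the lower left entry `z` of its
matrix is nonzero (`schottky_one_zero_eq_zero_iff`). As `z` is an integer, `1 - z ^ 2 > 0` exactly
for the identity, and `z ^ 2` is an entry of the Kronecker square, so a weighted automaton computes
this value. Turakainen's construction makes it probabilistic. -/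

/-- Transport of a probabilistic automaton along a bijection of its state set. -/
def reindex (e : Q ≃ Q') (M : PFA A Q) : PFA A Q' where
  trans a := Matrix.reindexAlgEquiv ℝ ℝ e (M.trans a)
  trans_stochastic a := by
    have h := mem_rowStochastic_iff_sum.1 (M.trans_stochastic a)
    refine mem_rowStochastic_iff_sum.2 ⟨fun i j => h.1 _ _, fun i => ?_⟩
    rw [← h.2 (e.symm i)]
    exact Equiv.sum_comp e.symm fun j => M.trans a (e.symm i) j
  start := e M.start
  accept := M.accept.map e.toEmbedding

theorem acceptProb_reindex (e : Q ≃ Q') (M : PFA A Q) (w : List A) :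
    (M.reindex e).acceptProb w = M.acceptProb w := by
  have h : (w.map (M.reindex e).trans).prod
      = Matrix.reindexAlgEquiv ℝ ℝ e (w.map M.trans).prod := by
    rw [map_list_prod, List.map_map]
    rfl
  rw [acceptProb, h]
  simp [acceptProb, reindex]

theorem acceptProb_nil (M : PFA A Q) (h : M.start ∈ M.accept) : M.acceptProb [] = 1 := by
  simp [acceptProb, Matrix.one_apply, h]

end PFA

section Turakainen

variable {A Q ι : Type*} [Fintype Q] [DecidableEq Q] [Fintype ι] [DecidableEq ι]

/-- Products of the matrices `δ • U B V + J`, where `J` is a multiple of the all-ones matrix. -/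
theorem prod_map_smul_add (B : A → Matrix ι ι ℝ) (U : Matrix Q ι ℝ) (V : Matrix ι Q ℝ)
    (J : Matrix Q Q ℝ) (hVU : V * U = 1) (hJU : J * U = 0) (hVJ : V * J = 0) (hJJ : J * J = J)
    (δ : ℝ) (a : A) (w : List A) :
    ((a :: w).map fun a => δ • (U * B a * V) + J).prod
      = δ ^ (w.length + 1) • (U * ((a :: w).map B).prod * V) + J := by
  induction w generalizing a with
  | nil => simp
  | cons b w ih =>
    rw [List.map_cons, List.prod_cons, ih b, List.map_cons (f := B) (a := a),
      List.prod_cons (a := B a)]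
    generalize ((b :: w).map B).prod = P
    have h1 : U * B a * V * (U * P * V) = U * (B a * P) * V := by
      calc U * B a * V * (U * P * V) = U * B a * (V * U) * P * V := by
            simp only [Matrix.mul_assoc]
        _ = U * (B a * P) * V := by rw [hVU]; simp only [Matrix.mul_assoc, Matrix.one_mul]
    have h2 : J * (U * P * V) = 0 := by
      rw [Matrix.mul_assoc, ← Matrix.mul_assoc, hJU, Matrix.zero_mul]
    have h3 : U * B a * V * J = 0 := by rw [Matrix.mul_assoc, hVJ, Matrix.mul_zero]
    rw [add_mul, mul_add, mul_add, smul_mul_smul_comm, smul_mul_assoc, mul_smul_comm, h1, h2, h3,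
      hJJ, List.length_cons, pow_succ' δ (w.length + 1)]
    simp

/-- A finite family of real matrices can be scaled below any positive bound. -/
theorem exists_pos_forall_abs_mul_le {A Q : Type*} [Finite A] [Finite Q] (C : A → Matrix Q Q ℝ) {ε : ℝ} (hε : 0 < ε) :
    ∃ δ : ℝ, 0 < δ ∧ ∀ a i j, |δ * C a i j| ≤ ε := by
  obtain ⟨K, hK⟩ := (Set.finite_range fun x : A × Q × Q => |C x.1 x.2.1 x.2.2|).bddAbove
  have hK' : ∀ a i j, |C a i j| ≤ |K| + 1 := fun a i j =>
    (hK ⟨(a, i, j), rfl⟩).trans ((le_abs_self K).trans (by linarith))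
  have hpos : 0 < |K| + 1 := by positivity
  refine ⟨ε / (|K| + 1), by positivity, fun a i j => ?_⟩
  rw [abs_mul, abs_of_pos (by positivity : 0 < ε / (|K| + 1)), div_mul_eq_mul_div, div_le_iff₀ hpos]
  exact mul_le_mul_of_nonneg_left (hK' a i j) hε.le

/-- **Turakainen's theorem**: a strict cut-point language of a real weighted automaton that contains
the empty word is accepted by a probabilistic automaton with cut-point. -/
theorem exists_pfa_acceptsWithCutPoint [Finite A] (B : A → Matrix ι ι ℝ) (u v : ι → ℝ)
    (huv : 0 < u ⬝ᵥ v) :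
    ∃ (n : ℕ) (M : PFA A (Fin n)) (c : ℝ), 0 ≤ c ∧ c < 1 ∧
      M.AcceptsWithCutPoint {w | 0 < u ⬝ᵥ ((w.map B).prod *ᵥ v)} c := by
  -- The rows `-(1 + u)` and columns `-(1 + v)` make all column sums of `U` and row sums of `V`
  -- vanish; the zeros are staggered to keep `V * U = 1`.
  let U : Matrix (ι ⊕ Fin 4) ι ℝ := fromRows 1 (of ![u, fun i => -(1 + u i), 0, 0])
  let V : Matrix ι (ι ⊕ Fin 4) ℝ := fromCols 1 (of fun i => ![0, 0, v i, -(1 + v i)])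
  let N : ℝ := Fintype.card (ι ⊕ Fin 4)
  have hN4 : 4 ≤ N := by simp [N]
  have hN : N ≠ 0 := by positivity
  let J : Matrix (ι ⊕ Fin 4) (ι ⊕ Fin 4) ℝ := of fun _ _ => N⁻¹
  have hVU : V * U = 1 := by
    have h : (of fun i => ![0, 0, v i, -(1 + v i)]) * of ![u, fun i => -(1 + u i), 0, 0]
        = (0 : Matrix ι ι ℝ) := by
      ext i j
      simp [Matrix.mul_apply, Fin.sum_univ_four]
    simp only [U, V, fromCols_mul_fromRows, h, Matrix.one_mul, add_zero]
  have hU : ∀ j, ∑ i, U i j = 0 := fun j => by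
    simp [U, Fin.sum_univ_four, Matrix.one_apply]
  have hV : ∀ i, ∑ j, V i j = 0 := fun i => by
    simp [V, Fin.sum_univ_four, Matrix.one_apply]
  have hJU : J * U = 0 := by
    ext i j
    simp [J, Matrix.mul_apply, ← Finset.mul_sum, hU]
  have hVJ : V * J = 0 := by
    ext i j
    simp [J, Matrix.mul_apply, ← Finset.sum_mul, hV]
  have hJrow : ∀ i, ∑ j, J i j = 1 := fun i => by
    simp only [J, of_apply, Finset.sum_const, Finset.card_univ, nsmul_eq_mul]
    exact mul_inv_cancel₀ hN
  have hJJ : J * J = J := by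
    ext i j
    have := hJrow i
    simp only [Matrix.mul_apply, J, of_apply] at this ⊢
    rw [← Finset.sum_mul, this, one_mul]
  have hCrow : ∀ a i, ∑ j, (U * B a * V) i j = 0 := fun a i => by
    simp only [Matrix.mul_apply (M := U * B a)]
    rw [Finset.sum_comm]
    simp [← Finset.mul_sum, hV]
  obtain ⟨δ, hδ, hle⟩ := exists_pos_forall_abs_mul_le (fun a => U * B a * V)
    (inv_pos.2 (by positivity : 0 < N))
  let M : PFA A (ι ⊕ Fin 4) :=
    { trans := fun a => δ • (U * B a * V) + J
      trans_stochastic := fun a => by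
        refine mem_rowStochastic_iff_sum.2 ⟨fun i j => ?_, fun i => ?_⟩
        · have := neg_le_of_abs_le (hle a i j)
          simp only [Matrix.add_apply, Matrix.smul_apply, smul_eq_mul, J, of_apply]
          linarith
        · simp only [Matrix.add_apply, Matrix.smul_apply, smul_eq_mul, Finset.sum_add_distrib,
            ← Finset.mul_sum, hCrow, hJrow, mul_zero, zero_add]
      -- State `inr 2` carries the value. State `inr 0` adds only the constant `N⁻¹` on nonempty
      -- words, but makes the empty word, where no `J` appears, accepted with probability 1.
      start := Sum.inr 0
      accept := {Sum.inr 0, Sum.inr 2} }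
  have hUBV : ∀ P : Matrix ι ι ℝ, (U * P * V) (Sum.inr 0) (Sum.inr 0) = 0 ∧
      (U * P * V) (Sum.inr 0) (Sum.inr 2) = u ⬝ᵥ (P *ᵥ v) := fun P => by
    constructor
    · simp [Matrix.mul_apply, V]
    · rw [Matrix.dotProduct_mulVec]
      simp [Matrix.mul_apply, U, V, dotProduct, vecMul]
  have hcons : ∀ a w, M.acceptProb (a :: w)
      = δ ^ (w.length + 1) * (u ⬝ᵥ (((a :: w).map B).prod *ᵥ v)) + 2 * N⁻¹ := fun a w => by
    obtain ⟨h0, h2⟩ := hUBV ((a :: w).map B).prod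
    have hne : (Sum.inr 0 : ι ⊕ Fin 4) ≠ Sum.inr 2 := by simp
    rw [PFA.acceptProb, Finset.sum_pair hne,
      prod_map_smul_add B U V J hVU hJU hVJ hJJ δ a w]
    simp only [Matrix.add_apply, Matrix.smul_apply, smul_eq_mul, M, h0, h2, J, of_apply]
    ring
  have hc : 2 * N⁻¹ < 1 := by
    rw [← div_eq_mul_inv, div_lt_one (by positivity)]
    linarith
  refine ⟨_, M.reindex (Fintype.equivFin _), 2 * N⁻¹, by positivity, hc, ?_, ?_⟩
  · intro w hw
    rw [PFA.acceptProb_reindex]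
    cases w with
    | nil => rwa [PFA.acceptProb_nil M (by simp [M])]
    | cons a w =>
      rw [hcons]
      have := mul_pos (pow_pos hδ (w.length + 1)) hw
      linarith
  · intro w hw
    rw [PFA.acceptProb_reindex]
    cases w with
    | nil => exact absurd (show 0 < u ⬝ᵥ (1 *ᵥ v) by simpa using huv) hw
    | cons a w =>
      rw [hcons]
      have := mul_nonpos_of_nonneg_of_nonpos (pow_pos hδ (w.length + 1)).le (not_lt.1 hw)
      linarith

end Turakainen

/-! ### Ping-pong for a Schottky group -/

namespace FreeGroup

variable {X : Type*}

/-- The Möbius transformation `z ↦ p - 1 / (z - q)`, which maps the exterior of the unit disc around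
`q` to the interior of the unit disc around `p`. -/
def discSwap (p q : ℤ) : (Matrix (Fin 2) (Fin 2) ℤ)ˣ where
  val := !![p, -(p * q) - 1; 1, -q]
  inv := !![-q, p * q + 1; -1, p]
  val_inv := by
    rw [mul_fin_two, one_fin_two]
    ring_nf
  inv_val := by
    rw [mul_fin_two, one_fin_two]
    ring_nf

theorem discSwap_mul_apply (p q : ℤ) (P : (Matrix (Fin 2) (Fin 2) ℤ)ˣ) :
    (discSwap p q * P).val 0 0 = p * P.val 0 0 - (p * q + 1) * P.val 1 0 ∧
      (discSwap p q * P).val 1 0 = P.val 0 0 - q * P.val 1 0 := by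
  rw [Units.val_mul]
  constructor <;> simp [discSwap, Matrix.mul_apply, Fin.sum_univ_two] <;> ring

theorem discSwap_inv_mul_apply (p q : ℤ) (P : (Matrix (Fin 2) (Fin 2) ℤ)ˣ) :
    ((discSwap p q)⁻¹ * P).val 0 0 = -(q * P.val 0 0 - (q * p + 1) * P.val 1 0) ∧
      ((discSwap p q)⁻¹ * P).val 1 0 = -(P.val 0 0 - p * P.val 1 0) := by
  have h : (discSwap p q)⁻¹.val = !![-q, p * q + 1; -1, p] := rfl
  rw [Units.val_mul, h]
  constructor <;> simp [Matrix.mul_apply, Fin.sum_univ_two] <;> ring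

/-- The Schottky representation of the free group for unit discs with integral centres. -/
def schottky (c : X × Bool → ℤ) : FreeGroup X →* (Matrix (Fin 2) (Fin 2) ℤ)ˣ :=
  lift fun x => discSwap (c (x, true)) (c (x, false))

/-- The inverse of `discSwap p q` is `-discSwap q p`, so up to sign one formula covers both kinds of
letters. -/
theorem schottky_cons (c : X × Bool → ℤ) (l : X × Bool) (w : List (X × Bool)) :
    ∃ s : ℤ, |s| = 1 ∧
      (schottky c (mk (l :: w))).val 0 0 = s * (c l * (schottky c (mk w)).val 0 0
        - (c l * c (l.1, !l.2) + 1) * (schottky c (mk w)).val 1 0) ∧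
      (schottky c (mk (l :: w))).val 1 0 = s * ((schottky c (mk w)).val 0 0
        - c (l.1, !l.2) * (schottky c (mk w)).val 1 0) := by
  have h : schottky c (mk (l :: w)) = cond l.2 (discSwap (c (l.1, true)) (c (l.1, false)))
      (discSwap (c (l.1, true)) (c (l.1, false)))⁻¹ * schottky c (mk w) := by
    simp [schottky, lift_mk]
  rw [h]
  obtain ⟨x, _ | _⟩ := l
  · exact ⟨-1, by simp, by simpa using discSwap_inv_mul_apply _ _ _⟩
  · exact ⟨1, by simp, by simpa using discSwap_mul_apply _ _ _⟩

/-- The first column is the image of ∞ in homogeneous coordinates, which lets ∞ itself count as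
outside every disc. -/
theorem schottky_cons_mem_disc (c : X × Bool → ℤ) (l : X × Bool) (w : List (X × Bool))
    (h : |(schottky c (mk w)).val 1 0|
      < |(schottky c (mk w)).val 0 0 - c (l.1, !l.2) * (schottky c (mk w)).val 1 0|) :
    |(schottky c (mk (l :: w))).val 0 0 - c l * (schottky c (mk (l :: w))).val 1 0|
      < |(schottky c (mk (l :: w))).val 1 0| := by
  obtain ⟨s, hs, h0, h1⟩ := schottky_cons c l w
  rw [h0, h1, abs_mul s, hs, one_mul]
  refine lt_of_eq_of_lt ?_ h
  rw [show ∀ p q x y : ℤ, s * (p * x - (p * q + 1) * y) - p * (s * (x - q * y)) = s * -y by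
    intros; ring, abs_mul, hs, one_mul, abs_neg]

/-- Ping-pong: the tail sends ∞ into the disc of its first letter `l'`, which is disjoint from that
of the inverse of `l` because `l'` does not cancel `l`. -/
theorem schottky_notMem_disc {c : X × Bool → ℤ} (hc : ∀ l l', l ≠ l' → 2 ≤ |c l - c l'|)
    (w : List (X × Bool)) (l : X × Bool) (h : IsReduced (l :: w)) :
    |(schottky c (mk w)).val 1 0|
      < |(schottky c (mk w)).val 0 0 - c (l.1, !l.2) * (schottky c (mk w)).val 1 0| := by
  induction w generalizing l with
  | nil => simp [← one_eq_mk]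
  | cons l' w ih =>
    rw [isReduced_cons_cons] at h
    have hne : l' ≠ (l.1, !l.2) := by
      rintro rfl
      simpa using h.1 rfl
    have hlt := schottky_cons_mem_disc c l' w (ih l' h.2)
    have h2 := mul_le_mul_of_nonneg_right (hc _ _ hne)
      (abs_nonneg ((schottky c (mk (l' :: w))).val 1 0))
    rw [← abs_mul] at h2
    have h3 := abs_sub_abs_le_abs_sub
      ((c l' - c (l.1, !l.2)) * (schottky c (mk (l' :: w))).val 1 0)
      (-((schottky c (mk (l' :: w))).val 0 0 - c l' * (schottky c (mk (l' :: w))).val 1 0))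
    rw [abs_neg] at h3
    refine lt_of_lt_of_le (by linarith) (h3.trans_eq (congrArg _ ?_))
    ring

/-- The lower left entry of the Schottky representation detects the identity. -/
theorem schottky_one_zero_eq_zero_iff {c : X × Bool → ℤ}
    (hc : ∀ l l', l ≠ l' → 2 ≤ |c l - c l'|) (g : FreeGroup X) :
    (schottky c g).val 1 0 = 0 ↔ g = 1 := by
  classical
  refine ⟨fun h => ?_, by rintro rfl; simp⟩
  have hred := isReduced_toWord (x := g)
  rw [← mk_toWord (x := g)] at h ⊢
  revert h hred
  cases g.toWord with
  | nil => exact fun _ _ => rfl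
  | cons l w =>
    intro h hred
    have := schottky_cons_mem_disc c l w (schottky_notMem_disc hc w l hred)
    rw [h, abs_zero] at this
    exact absurd this (abs_nonneg _).not_gt

theorem exists_separated_centres (X : Type*) [Finite X] :
    ∃ c : X × Bool → ℤ, ∀ l l', l ≠ l' → 2 ≤ |c l - c l'| := by
  obtain ⟨n, ⟨e⟩⟩ := Finite.exists_equiv_fin (X × Bool)
  refine ⟨fun l => 2 * (e l : ℕ), fun l l' hne => ?_⟩
  have h : ((e l : ℕ) : ℤ) ≠ (e l' : ℕ) := fun h =>
    hne (e.injective (Fin.ext (Nat.cast_injective h)))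
  rw [← mul_sub, abs_mul, abs_two]
  have := Int.one_le_abs (sub_ne_zero.2 h)
  linarith

theorem dotProduct_fromBlocks_kronecker_mulVec (P : Matrix (Fin 2) (Fin 2) ℝ) :
    Sum.elim (1 : Unit → ℝ) (-Pi.single (1, 1) 1) ⬝ᵥ
      (fromBlocks (1 : Matrix Unit Unit ℝ) 0 0 (kroneckerMap (· * ·) P P) *ᵥ
        Sum.elim 1 (Pi.single (0, 0) 1))
      = 1 - P 1 0 * P 1 0 := by
  simp [fromBlocks_mulVec, sub_eq_add_neg]

/-- A free group of finite rank has a word problem defined by a real weighted automaton. -/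
theorem exists_weighted_wordProblem (X : Type*) [Finite X] :
    ∃ (B : X × Bool → Matrix (Unit ⊕ Fin 2 × Fin 2) (Unit ⊕ Fin 2 × Fin 2) ℝ)
      (u v : Unit ⊕ Fin 2 × Fin 2 → ℝ),
      ∀ w, 0 < u ⬝ᵥ ((w.map B).prod *ᵥ v) ↔ mk w = (1 : FreeGroup X) := by
  obtain ⟨c, hc⟩ := exists_separated_centres X
  let R : FreeGroup X →* Matrix (Fin 2) (Fin 2) ℝ :=
    ((Int.castRingHom ℝ).mapMatrix.toMonoidHom.comp (Units.coeHom _)).comp (schottky c)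
  refine ⟨fun l => fromBlocks 1 0 0 (kroneckerMap (· * ·) (R (mk [l])) (R (mk [l]))),
    Sum.elim 1 (-Pi.single (1, 1) 1), Sum.elim 1 (Pi.single (0, 0) 1), fun w => ?_⟩
  have hprod : (w.map fun l =>
      fromBlocks (1 : Matrix Unit Unit ℝ) 0 0 (kroneckerMap (· * ·) (R (mk [l])) (R (mk [l])))).prod
      = fromBlocks 1 0 0 (kroneckerMap (· * ·) (R (mk w)) (R (mk w))) := by
    induction w with
    | nil =>
      rw [← one_eq_mk, R.map_one]
      simp [kroneckerMap_one_one]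
    | cons l w ih =>
      rw [List.map_cons, List.prod_cons, ih, fromBlocks_multiply, ← mul_kronecker_mul, ← R.map_mul,
        mul_mk]
      simp
  rw [hprod, ← schottky_one_zero_eq_zero_iff hc]
  have hval : R (mk w) 1 0 = ((schottky c (mk w)).val 1 0 : ℤ) := rfl
  rw [dotProduct_fromBlocks_kronecker_mulVec, hval]
  generalize (schottky c (mk w)).val 1 0 = z
  norm_cast
  constructor
  · intro h
    by_contra hz
    have := Int.one_le_abs hz
    nlinarith [abs_mul_abs_self z]
  · rintro rfl
    simp

end FreeGroup

theorem corollary3p7 (X : Type*) [Finite X] :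
    ∃ (n : ℕ) (M : PFA (X × Bool) (Fin n)) (c : ℝ),
      0 ≤ c ∧ c < 1 ∧ M.AcceptsWithCutPoint (freeGroupWordProblem X) c := by
  obtain ⟨B, u, v, h⟩ := FreeGroup.exists_weighted_wordProblem X
  have hL : freeGroupWordProblem X = {w | 0 < u ⬝ᵥ ((w.map B).prod *ᵥ v)} :=
    Set.ext fun w => (h w).symm
  rw [hL]
  exact exists_pfa_acceptsWithCutPoint B u v (by simpa using (h []).2 rfl)
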